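/- Let $\mathcal H,\mathcal G$ be real Hilbert spaces. A bounded self-adjoint operator $A$ is positive if $\langle Ax,x\rangle\ge 0$ for all $x$; write $A\preccurlyeq B$ if $B-A$ is positive, and let $\mathscr S(\mathcal H)$ be the set of strictly positive operators on $\mathcal H$, i.e. the positive operators $A$ with $\alpha\,\mathrm{Id}_{\mathcal H}\preccurlyeq A$ for some $\alpha>0$. The Thompson metric on $\mathscr S(\mathcal H)$ is $d_{\mathcal H}(A,B)=\ln\max\{g(A,B),g(B,A)\}$ with $g(A,B)=\inf\{\lambda>0 : A\preccurlyeq\lambda B\}$ (and $d_{\mathcal H}=0$ if $\mathcal H=\{0\}$), and the $t$-weighted geometric mean of $A,B\in\mathscr S(\mathcal G)$ is $A\#_tB=A^{1/2}\bigl(A^{-1/2}BA^{-1/2}\bigr)^tA^{1/2}$. For a bounded linear operator $L\colon\mathcal H\to\mathcal G$, $\gamma>0$, and a set-valued operator $M\colon\mathcal G\to 2^{\mathcal G}$, the parallel composition is $L^*\triangleright M=(L^*\circ M^{-1}\circ L)^{-1}$, the resolvent composition is $L\diamond_\gamma M=L^*\triangleright(M+\gamma^{-1}\mathrm{Id}_{\mathcal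 G})-\gamma^{-1}\mathrm{Id}_{\mathcal H}$, and the resolvent cocomposition is $L\blacktriangleright_\gamma M=(L\diamond_{1/\gamma}M^{-1})^{-1}$, all inverses being inverses of set-valued operators; a bounded linear operator is identified with the single-valued operator that it defines. Suppose that $L$ is bounded below (there is $\alpha>0$ with $\alpha\|x\|\le\|Lx\|$ for all $x\in\mathcal H$) and $\|L\|\le 1$, and let $B\in\mathscr S(\mathcal G)$, $\gamma\in(0,+\infty)$ and $t\in(0,1)$. Then the following hold. (i) $\varphi\colon X\mapsto L\blacktriangleright_\gamma(X\#_tB)$ is a well-defined map from $(\mathscr S(\mathcal G),d_{\mathcal G})$ to $(\mathscr S(\mathcal H),d_{\mathcal H})$, and it is $(1-t)$-Lipschitzian: $d_{\mathcal H}(\varphi(X),\varphi(Y))\le(1-t)\,d_{\mathcal G}(X,Y)$ for all $X,Y\in\mathscr S(\mathcal G)$. (ii) If $\mathcal H=\mathcal G$, then there is exactly one $X\in\mathscr S(\mathcal H)$ such that $X=L\blacktriangleright_\gamma(X\#_tB)$. -/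

import Mathlib

/-! Continuous functional calculus for self-adjoint operators on a real Hilbert space: it is built
here from polynomials, so that the powers `A ^ r` of Mathlib are available over the reals. -/

namespace RealHilbert

open Polynomial

section

variable {H : Type*} [NormedAddCommGroup H] [InnerProductSpace ℝ H] [CompleteSpace H]

theorem isSelfAdjoint_aeval {a : H →L[ℝ] H} (ha : IsSelfAdjoint a) (p : ℝ[X]) :
    IsSelfAdjoint (aeval a p) := by
  induction p using Polynomial.induction_on' with
  | add p q hp hq => rw [map_add]; exact hp.add hq
  | monomial n c =>
    rw [aeval_monomial, ← Algebra.smul_def]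
    exact (IsSelfAdjoint.all c).smul (ha.pow n)

theorem isUnit_sq_add {b : H →L[ℝ] H} (hb : IsSelfAdjoint b) {d : ℝ} (hd : 0 < d) :
    IsUnit (b * b + d • (1 : H →L[ℝ] H)) := by
  refine ContinuousLinearMap.isUnit_of_forall_le_norm_inner_map _ (c := ⟨d, hd.le⟩) hd fun x ↦ ?_
  have h1 : inner ℝ (b (b x)) x = ‖b x‖ ^ 2 := by
    rw [← real_inner_self_eq_norm_sq]
    exact hb.isSymmetric (b x) x
  have h2 : inner ℝ ((b * b + d • (1 : H →L[ℝ] H)) x) x = ‖b x‖ ^ 2 + d * ‖x‖ ^ 2 := by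
    simp [inner_add_left, h1, inner_smul_left]
  rw [h2, Real.norm_eq_abs, abs_of_nonneg (by positivity)]
  change ‖x‖ ^ 2 * d ≤ _
  nlinarith [sq_nonneg ‖b x‖]

theorem isUnit_aeval {a : H →L[ℝ] H} (ha : IsSelfAdjoint a) (p : ℝ[X])
    (hp : ∀ x ∈ spectrum ℝ a, p.eval x ≠ 0) (hp0 : p ≠ 0) : IsUnit (aeval a p) := by
  induction p using WfDvdMonoid.induction_on_irreducible with
  | zero => exact absurd rfl hp0
  | unit u hu => exact hu.map (aeval a)
  | mul p q hp0' hq ih =>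
    rw [map_mul]
    refine IsUnit.mul ?_ (ih (fun x hx h => hp x hx (by simp [h])) hp0')
    by_cases hr : ∃ r, q.IsRoot r
    · obtain ⟨r, hr⟩ := hr
      have hrs : r ∉ spectrum ℝ a := fun h => hp r h (by simp [hr.eq_zero])
      obtain ⟨s, hs⟩ := dvd_iff_isRoot.mpr hr
      have hsu : IsUnit s := (hq.isUnit_or_isUnit hs).resolve_left (not_isUnit_X_sub_C r)
      rw [hs, map_mul]
      refine IsUnit.mul ?_ (hsu.map (aeval a))
      rw [spectrum.notMem_iff, IsUnit.sub_iff] at hrs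
      simpa using hrs
    · push Not at hr
      obtain ⟨u, v, w, rfl⟩ : ∃ u v w : ℝ, q = C u * X ^ 2 + C v * X + C w :=
        ⟨_, _, _, eq_quadratic_of_degree_le_two hq.degree_le_two⟩
      simp only [IsRoot.def, eval_add, eval_mul, eval_C, eval_pow, eval_X] at hr
      by_cases hu : u = 0
      · subst hu
        by_cases hv : v = 0
        · subst hv
          have hw : w ≠ 0 := by simpa using hr 0
          have : IsUnit (C w) := isUnit_C.mpr hw.isUnit
          simpa using this.map (aeval a)
        · exact absurd (by field_simp; ring) (hr (-w / v))
      · have hd : 0 < 4 * u * w - v ^ 2 := by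
          by_contra! h
          have hs := Real.mul_self_sqrt (show 0 ≤ v ^ 2 - 4 * u * w by linarith)
          obtain ⟨x, hx⟩ := exists_quadratic_eq_zero (b := v) (c := w) hu ⟨_, hs.symm⟩
          exact hr x (by rw [pow_two]; exact hx)
        have hb : IsSelfAdjoint (aeval a (C (2 * u) * X + C v)) := isSelfAdjoint_aeval ha _
        have key := isUnit_sq_add hb hd
        have e : aeval a (C (2 * u) * X + C v) * aeval a (C (2 * u) * X + C v)
            + (4 * u * w - v ^ 2) • (1 : H →L[ℝ] H)
            = aeval a (C (4 * u)) * aeval a (C u * X ^ 2 + C v * X + C w) := by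
          rw [← map_mul, ← map_mul, ← Algebra.algebraMap_eq_smul_one, ← aeval_C, ← map_add]
          congr 1
          simp only [map_sub, map_mul, map_pow, C_ofNat]
          ring
        rw [e] at key
        have hu4 : IsUnit (aeval a (C (4 * u))) :=
          (isUnit_C.mpr (show (4 * u) ≠ 0 by simpa using hu).isUnit).map (aeval a)
        obtain ⟨k, hk⟩ := hu4
        rw [← hk] at key
        exact (Units.isUnit_units_mul k _).mp key

theorem spectrum_nonempty [Nontrivial (H →L[ℝ] H)] {a : H →L[ℝ] H} (ha : IsSelfAdjoint a) :
    (spectrum ℝ a).Nonempty := by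
  by_contra! he
  have hr := ContinuousLinearMap.spectralRadius_eq_nnnorm a ha
  have h0 : a = 0 := by
    have h1 : (0 : ENNReal) = ‖a‖₊ := by simpa [spectralRadius, he] using hr
    exact nnnorm_eq_zero.mp (by exact_mod_cast h1.symm)
  simp [h0] at he

theorem spectrum_aeval {a : H →L[ℝ] H} (ha : IsSelfAdjoint a) (p : ℝ[X]) :
    spectrum ℝ (aeval a p) = (p.eval ·) '' spectrum ℝ a := by
  refine Set.Subset.antisymm (fun k hk => ?_) (spectrum.subset_polynomial_aeval a p)
  by_contra h
  rcases subsingleton_or_nontrivial (H →L[ℝ] H) with hs | hn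
  · simp [spectrum.of_subsingleton] at hk
  have hne := spectrum_nonempty ha
  have hu : IsUnit (aeval a (p - C k)) := by
    refine isUnit_aeval ha _ (fun x hx h0 => h ⟨x, hx, ?_⟩) ?_
    · simpa [sub_eq_zero] using h0
    · rintro h0
      obtain ⟨x, hx⟩ := hne
      exact h ⟨x, hx, by simpa [sub_eq_zero] using congrArg (eval x) h0⟩
  rw [spectrum.mem_iff, IsUnit.sub_iff] at hk
  exact hk (by simpa using hu)

theorem norm_aeval {a : H →L[ℝ] H} (ha : IsSelfAdjoint a) {K : Set ℝ} [CompactSpace K]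
    (hK : spectrum ℝ a = K) (p : ℝ[X]) : ‖aeval a p‖ = ‖p.toContinuousMapOn K‖ := by
  have hr := ContinuousLinearMap.spectralRadius_eq_nnnorm (aeval a p) (isSelfAdjoint_aeval ha p)
  apply le_antisymm
  · have : (‖aeval a p‖₊ : ENNReal) ≤ ‖p.toContinuousMapOn K‖₊ := by
      rw [← hr, spectralRadius, spectrum_aeval ha, hK]
      refine iSup₂_le ?_
      rintro _ ⟨x, hx, rfl⟩
      exact_mod_cast (p.toContinuousMapOn K).norm_coe_le_norm ⟨x, hx⟩
    exact_mod_cast this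
  · refine (ContinuousMap.norm_le _ (norm_nonneg _)).mpr ?_
    rintro ⟨x, hx⟩
    have hx' : p.eval x ∈ spectrum ℝ (aeval a p) := by
      rw [spectrum_aeval ha, hK]
      exact ⟨x, hx, rfl⟩
    have : (‖p.eval x‖₊ : ENNReal) ≤ ‖aeval a p‖₊ := by
      rw [← hr]
      exact le_iSup₂ (f := fun k (_ : k ∈ spectrum ℝ (aeval a p)) => (‖k‖₊ : ENNReal)) _ hx'
    exact_mod_cast this

theorem dense_polynomial (s : Set ℝ) [CompactSpace s] :
    DenseRange (toContinuousMapOnAlgHom (R := ℝ) s) := by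
  have h := polynomialFunctions.topologicalClosure s
  intro f
  have hf : f ∈ (polynomialFunctions s).topologicalClosure := by rw [h]; trivial
  have := hf
  rw [← SetLike.mem_coe, Subalgebra.topologicalClosure_coe, polynomialFunctions_coe] at this
  exact this

theorem exists_cfc {a : H →L[ℝ] H} (ha : IsSelfAdjoint a) (K : Set ℝ) [CompactSpace K]
    (hK : spectrum ℝ a = K) :
    ∃ φ : C(K, ℝ) →⋆ₐ[ℝ] (H →L[ℝ] H),
      Continuous φ ∧ Function.Injective φ ∧
        φ ((ContinuousMap.id ℝ).restrict K) = a ∧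
          (∀ f, spectrum ℝ (φ f) = Set.range f) ∧ ∀ f, IsSelfAdjoint (φ f) := by
  let i : ℝ[X] →+* C(K, ℝ) := (toContinuousMapOnAlgHom (R := ℝ) K).toRingHom
  let f : ℝ[X] →+* (H →L[ℝ] H) := (aeval a).toRingHom
  have hif : ∀ p, ‖f p‖ = ‖i p‖ := norm_aeval ha hK
  let _ : UniformSpace ℝ[X] := UniformSpace.comap i inferInstance
  have ui : IsUniformInducing i := ⟨rfl⟩
  have dr : DenseRange i := dense_polynomial _
  have uf : UniformContinuous f := by
    refine ((ui.basis_uniformity Metric.uniformity_basis_dist).uniformContinuous_iff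
      Metric.uniformity_basis_dist).mpr fun ε hε => ⟨ε, hε, fun p q hpq => ?_⟩
    have hpq' : dist (i p) (i q) < ε := hpq
    change dist (f p) (f q) < ε
    rw [dist_eq_norm, ← map_sub] at hpq' ⊢
    rwa [hif]
  let φ : C(K, ℝ) →+* (H →L[ℝ] H) := IsDenseInducing.extendRingHom ui dr uf
  have hφ : Continuous φ := (uniformContinuous_uniformly_extend ui dr uf).continuous
  have hφi : ∀ p, φ (i p) = f p := fun p =>
    IsDenseInducing.extend_eq (ui.isDenseInducing dr) uf.continuous p
  have hnorm : ∀ g, ‖φ g‖ = ‖g‖ := fun g => by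
    refine dr.induction_on (p := fun g => ‖φ g‖ = ‖g‖) g
      (isClosed_eq hφ.norm (by exact continuous_norm)) fun p => ?_
    rw [hφi, hif]
  have hsa : ∀ g, IsSelfAdjoint (φ g) := fun g => by
    refine dr.induction_on (p := fun g => IsSelfAdjoint (φ g)) g
      (isClosed_eq hφ.star hφ) fun p => ?_
    rw [hφi]
    exact isSelfAdjoint_aeval ha p
  have hC : ∀ r : ℝ, φ (algebraMap ℝ _ r) = algebraMap ℝ _ r := fun r => by
    have h1 : i (C r) = algebraMap ℝ _ r :=
      (toContinuousMapOnAlgHom (R := ℝ) K).commutes r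
    rw [← h1, hφi]
    exact (aeval a).commutes r
  let Φ : C(K, ℝ) →⋆ₐ[ℝ] (H →L[ℝ] H) :=
    { φ with
      commutes' := hC
      map_star' := fun g => by
        change φ (star g) = star (φ g)
        rw [(hsa g).star_eq, star_trivial] }
  refine ⟨Φ, hφ, ?_, ?_, fun g => ?_, hsa⟩
  · exact (injective_iff_map_eq_zero φ).mpr fun g hg => by
      exact norm_eq_zero.mp (by rw [← hnorm, hg, norm_zero])
  · have h1 : i X = (ContinuousMap.id ℝ).restrict K := by
      ext x
      simp [i]
    change φ _ = a
    rw [← h1, hφi]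
    exact aeval_X a
  · change spectrum ℝ (φ g) = _
    apply Set.Subset.antisymm
    · intro k hk
      by_contra hr
      have hu : IsUnit (algebraMap ℝ C(K, ℝ) k - g) := by
        rw [ContinuousMap.isUnit_iff_forall_ne_zero]
        intro x hx
        exact hr ⟨x, (sub_eq_zero.mp hx).symm⟩
      have hu' := hu.map φ
      rw [map_sub, hC] at hu'
      exact hk hu'
    · rintro _ ⟨x, rfl⟩
      have hcl : IsClosed {g : C(K, ℝ) | g x ∈ spectrum ℝ (φ g)} := by
        have hset : {g : C(K, ℝ) | g x ∈ spectrum ℝ (φ g)}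
            = (fun g => algebraMap ℝ (H →L[ℝ] H) (g x) - φ g) ⁻¹' (nonunits (H →L[ℝ] H)) := rfl
        rw [hset]
        refine nonunits.isClosed.preimage ?_
        have : Continuous fun g : C(K, ℝ) => g x := by fun_prop
        exact ((continuous_algebraMap ℝ (H →L[ℝ] H)).comp this).sub hφ
      refine dr.induction_on (p := fun g => g x ∈ spectrum ℝ (φ g)) g hcl fun p => ?_
      rw [hφi]
      exact spectrum.subset_polynomial_aeval a p ⟨x, hK ▸ x.2, rfl⟩

/-- The continuous functional calculus of self-adjoint bounded operators on a real Hilbert space: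
the continuous extension of the polynomial functional calculus. -/
instance instCFC : ContinuousFunctionalCalculus ℝ (H →L[ℝ] H) IsSelfAdjoint where
  predicate_zero := .zero _
  spectrum_nonempty _ ha := spectrum_nonempty ha
  exists_cfc_of_predicate _ ha := exists_cfc ha _ rfl

/-- The order on operators is the Loewner order. With this instance and the preceding one, `A ^ r`
for a positive operator `A` and a real `r` is the power given by the functional calculus. -/
instance instStarOrderedRing : StarOrderedRing (H →L[ℝ] H) :=
  ContinuousLinearMap.instStarOrderedRingRCLike

end

section

variable {H G : Type*} [NormedAddCommGroup H] [InnerProductSpace ℝ H] [CompleteSpace H]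
  [NormedAddCommGroup G] [InnerProductSpace ℝ G] [CompleteSpace G]

variable (H) in
/-- The set of strictly positive operators: positive (that is, self-adjoint with
`0 ≤ ⟪A x, x⟫` for all `x`) and above a positive multiple of the identity in the Loewner order. -/
def StrictlyPositive : Set (H →L[ℝ] H) :=
  {A | A.IsPositive ∧ ∃ α : ℝ, 0 < α ∧ α • ContinuousLinearMap.id ℝ H ≤ A}

/-- The gauge `g(A, B) = inf {λ > 0 | A ≤ λ B}`. -/
noncomputable def thompsonGauge (A B : H →L[ℝ] H) : ℝ :=
  sInf {l : ℝ | 0 < l ∧ A ≤ l • B}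

/-- The Thompson metric `d(A, B) = ln (max {g(A, B), g(B, A)})`. -/
noncomputable def thompson (A B : H →L[ℝ] H) : ℝ :=
  Real.log (max (thompsonGauge A B) (thompsonGauge B A))

/-- `L` is bounded below. -/
def BoundedBelow (L : H →L[ℝ] G) : Prop :=
  ∃ α : ℝ, 0 < α ∧ ∀ x, α * ‖x‖ ≤ ‖L x‖

/-- The weighted geometric mean `A #ₜ B = A^(1/2) (A^(-1/2) B A^(-1/2))^t A^(1/2)`. -/
noncomputable def geomMean (t : ℝ) (A B : G →L[ℝ] G) : G →L[ℝ] G :=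
  A ^ (1 / 2 : ℝ) * (A ^ (-(1 / 2) : ℝ) * B * A ^ (-(1 / 2) : ℝ)) ^ t * A ^ (1 / 2 : ℝ)

/-- A bounded linear operator, seen as a set-valued operator. -/
def toSetOp (T : G →L[ℝ] G) : G → Set G := fun x => {T x}

/-- The inverse of a set-valued operator. -/
def invOp (M : G → Set G) : G → Set G := fun u => {x | u ∈ M x}

/-- The set-valued operator `M + c Id`. -/
def addId (M : G → Set G) (c : ℝ) : G → Set G := fun x => (fun u => u + c • x) '' M x

/-- The set-valued operator `L* ∘ M ∘ L`. -/
noncomputable def sandwich (L : H →L[ℝ] G) (M : G → Set G) : H → Set H :=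
  fun x => ContinuousLinearMap.adjoint L '' M (L x)

/-- The parallel composition `(L* ∘ M⁻¹ ∘ L)⁻¹` of `M` by `L*`. -/
noncomputable def parallelComp (L : H →L[ℝ] G) (M : G → Set G) : H → Set H :=
  invOp (sandwich L (invOp M))

/-- The resolvent composition: the parallel composition of `M + γ⁻¹ Id` by `L*`,
minus `γ⁻¹ Id`. -/
noncomputable def resolventComp (L : H →L[ℝ] G) (γ : ℝ) (M : G → Set G) : H → Set H :=
  addId (parallelComp L (addId M γ⁻¹)) (-γ⁻¹)

/-- The resolvent cocomposition: the inverse of the resolvent composition of `M⁻¹` with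
parameter `1 / γ`. -/
noncomputable def resolventCocomp (L : H →L[ℝ] G) (γ : ℝ) (M : G → Set G) : H → Set H :=
  invOp (resolventComp L (1 / γ) (invOp M))

end

end RealHilbert

open RealHilbert

namespace RealHilbert

open ContinuousLinearMap
open scoped Ring

/-! For strictly positive operators and `r ≥ 0`, `d(X, Y) ≤ r` means `X ≤ e^r Y` and `Y ≤ e^r X`. So
a map is `s`-Lipschitzian as soon as `X ≤ c Y` with `c ≥ 1` forces `f X ≤ c ^ s f Y`
(`thompson_le_mul_thompson`). The map of the theorem is a composition of two maps controlled in this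
way.

The mean `X #ₜ B` is homogeneous of degree `1 - t` in `X` (`geomMean_smul`) and monotone in `X`
(`geomMean_mono`), the latter because it is an integral of positive multiples of `(s B⁻¹ + X⁻¹)⁻¹`.
Hence it turns the constant `c` into `c ^ (1 - t)`.

The cocomposition keeps every constant `m ≥ 1` (`cocompOp_le_smul`). The parallel composition of a
strictly positive `E` is the operator `P E` with `⟪P E x, x⟫ = min {⟪E y, y⟫ | L* y = x}`. This
makes `P` monotone, and `‖L‖ ≤ 1` gives `P E + d Id ≤ P (E + d Id)` for `d ≥ 0`; both properties
survive the two inversions and the shifts by `γ`.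

For the fixed point, the Thompson metric is shown to be complete by comparison with the operator
norm, and Banach's theorem applies with constant `1 - t < 1`. -/

theorem inverse_eq_of_mul_eq_one {R : Type*} [MonoidWithZero R] {a b : R} (h : a * b = 1)
    (h' : b * a = 1) : a⁻¹ʳ = b :=
  Ring.inverse_unit ⟨a, b, h, h'⟩

/-! ### Quadratic forms and inverses -/

section

variable {H : Type*} [NormedAddCommGroup H] [InnerProductSpace ℝ H]

theorem inner_le_of_le {A B : H →L[ℝ] H} (h : A ≤ B) (x : H) :
    inner ℝ (A x) x ≤ inner ℝ (B x) x := by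
  have := ((le_def A B).mp h).inner_nonneg_left x
  rw [sub_apply, inner_sub_left] at this
  linarith

theorem inverse_apply_self {A : H →L[ℝ] H} (hA : IsUnit A) (x : H) : A⁻¹ʳ (A x) = x :=
  DFunLike.congr_fun (Ring.inverse_mul_cancel A hA) x

theorem apply_inverse_self {A : H →L[ℝ] H} (hA : IsUnit A) (x : H) : A (A⁻¹ʳ x) = x :=
  DFunLike.congr_fun (Ring.mul_inverse_cancel A hA) x

theorem inverse_smul {A : H →L[ℝ] H} (hA : IsUnit A) {c : ℝ} (hc : c ≠ 0) :
    (c • A)⁻¹ʳ = c⁻¹ • A⁻¹ʳ := by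
  refine inverse_eq_of_mul_eq_one ?_ ?_
  · rw [smul_mul_smul_comm, mul_inv_cancel₀ hc, Ring.mul_inverse_cancel _ hA, one_smul]
  · rw [smul_mul_smul_comm, inv_mul_cancel₀ hc, Ring.inverse_mul_cancel _ hA, one_smul]

end

/-! ### The Loewner order and strict positivity -/

section Order

variable {H : Type*} [NormedAddCommGroup H] [InnerProductSpace ℝ H] [CompleteSpace H]

theorem le_of_inner_le {A B : H →L[ℝ] H} (hA : IsSelfAdjoint A) (hB : IsSelfAdjoint B)
    (h : ∀ x, inner ℝ (A x) x ≤ inner ℝ (B x) x) : A ≤ B := by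
  rw [le_def, isPositive_iff']
  refine ⟨hB.sub hA, fun x => ?_⟩
  rw [sub_apply, inner_sub_left]
  linarith [h x]

theorem inner_map_comm {A : H →L[ℝ] H} (hA : IsSelfAdjoint A) (x y : H) :
    inner ℝ (A x) y = inner ℝ x (A y) := hA.isSymmetric x y

/-- For a self-adjoint operator both conditions say that the spectrum is contained in `(0, ∞)`;
compactness of the spectrum yields the uniform `α`. The zero algebra is treated apart. -/
theorem mem_strictlyPositive_iff {A : H →L[ℝ] H} :
    A ∈ StrictlyPositive H ↔ IsStrictlyPositive A := by
  rcases subsingleton_or_nontrivial (H →L[ℝ] H) with hs | hn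
  · refine ⟨fun _ => .of_subsingleton, fun _ => ⟨?_, 1, one_pos, (Subsingleton.elim _ _).le⟩⟩
    rw [Subsingleton.elim A 0]
    exact isPositive_zero
  constructor
  · rintro ⟨h, a, ha, hle⟩
    rw [CStarAlgebra.isStrictlyPositive_iff_isSelfAdjoint_and_spectrum_pos]
    refine ⟨h.isSelfAdjoint, ?_⟩
    refine (CFC.exists_pos_algebraMap_le_iff h.isSelfAdjoint).mp ⟨a, ha, ?_⟩
    rwa [Algebra.algebraMap_eq_smul_one]
  · intro h
    refine ⟨(nonneg_iff_isPositive A).mp h.nonneg, ?_⟩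
    obtain ⟨a, ha, hle⟩ := (CFC.exists_pos_algebraMap_le_iff h.isSelfAdjoint).mpr
      fun x hx => h.spectrum_pos hx
    exact ⟨a, ha, by rwa [Algebra.algebraMap_eq_smul_one] at hle⟩

theorem isStrictlyPositive_of_smul_one_le {A : H →L[ℝ] H} {c : ℝ} (hc : 0 < c)
    (h : c • (1 : H →L[ℝ] H) ≤ A) : IsStrictlyPositive A :=
  mem_strictlyPositive_iff.mp
    ⟨(nonneg_iff_isPositive A).mp ((smul_nonneg hc.le zero_le_one).trans h), c, hc, h⟩

theorem exists_smul_one_le {A : H →L[ℝ] H} (hA : IsStrictlyPositive A) :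
    ∃ c : ℝ, 0 < c ∧ c • (1 : H →L[ℝ] H) ≤ A :=
  (mem_strictlyPositive_iff.mpr hA).2

theorem isStrictlyPositive_of_le {A B : H →L[ℝ] H} (hA : IsStrictlyPositive A) (h : A ≤ B) :
    IsStrictlyPositive B := by
  obtain ⟨c, hc, hcA⟩ := exists_smul_one_le hA
  exact isStrictlyPositive_of_smul_one_le hc (hcA.trans h)

theorem le_norm_smul_one {A : H →L[ℝ] H} (hA : IsSelfAdjoint A) :
    A ≤ ‖A‖ • (1 : H →L[ℝ] H) := by
  refine le_of_inner_le hA ((IsSelfAdjoint.all _).smul (.one _)) fun x => ?_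
  rw [smul_apply, one_apply_eq_self, inner_smul_left, real_inner_self_eq_norm_sq]
  have h1 := real_inner_le_norm (A x) x
  have h2 := A.le_opNorm x
  simp only [conj_trivial]
  nlinarith [norm_nonneg x]

/-- With `u = A⁻¹ x` and `v = B⁻¹ x`, expanding `⟪A (u - v), u - v⟫ ≥ 0` gives `2 ⟪x, v⟫ ≤ ⟪x, u⟫ +
⟪A v, v⟫`, and `⟪A v, v⟫ ≤ ⟪B v, v⟫ = ⟪x, v⟫`. -/
theorem inverse_le_inverse {A B : H →L[ℝ] H} (hA : IsStrictlyPositive A) (h : A ≤ B) :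
    B⁻¹ʳ ≤ A⁻¹ʳ := by
  have hB := isStrictlyPositive_of_le hA h
  refine le_of_inner_le hB.ringInverse.isSelfAdjoint hA.ringInverse.isSelfAdjoint fun x => ?_
  set u := A⁻¹ʳ x with hu
  set v := B⁻¹ʳ x with hv
  have hAu : A u = x := apply_inverse_self hA.isUnit x
  have hBv : B v = x := apply_inverse_self hB.isUnit x
  have h1 := inner_le_of_le hA.nonneg (u - v)
  have h2 := inner_le_of_le h v
  have h3 := inner_map_comm hA.isSelfAdjoint v u
  simp only [map_sub, inner_sub_left, inner_sub_right, hAu, zero_apply, inner_zero_left] at h1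
  rw [hAu] at h3
  rw [hBv] at h2
  rw [real_inner_comm u x, real_inner_comm v x] at *
  linarith

end Order

/-! ### Set-valued calculus on bounded operators -/

section

variable {G : Type*} [NormedAddCommGroup G] [InnerProductSpace ℝ G]

theorem toSetOp_injective : Function.Injective (toSetOp (G := G)) := fun _ _ h =>
  ContinuousLinearMap.ext fun x => Set.singleton_injective (congrFun h x)

theorem invOp_toSetOp {C : G →L[ℝ] G} (hC : IsUnit C) : invOp (toSetOp C) = toSetOp C⁻¹ʳ := by
  ext u x
  simp only [invOp, toSetOp, Set.mem_ofPred_eq, Set.mem_singleton_iff]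
  constructor
  · rintro rfl
    exact (inverse_apply_self hC x).symm
  · rintro rfl
    exact (apply_inverse_self hC u).symm

theorem addId_toSetOp (C : G →L[ℝ] G) (c : ℝ) :
    addId (toSetOp C) c = toSetOp (C + c • (1 : G →L[ℝ] G)) := by
  ext x u
  simp [addId, toSetOp]

end

/-! ### Parallel composition and resolvent cocomposition -/

section ParallelComposition

variable {H G : Type*} [NormedAddCommGroup H] [InnerProductSpace ℝ H] [CompleteSpace H]
  [NormedAddCommGroup G] [InnerProductSpace ℝ G] [CompleteSpace G]

theorem isStrictlyPositive_adjoint_comp {L : H →L[ℝ] G} (hL : BoundedBelow L) {E : G →L[ℝ] G}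
    (hE : IsStrictlyPositive E) : IsStrictlyPositive (adjoint L ∘L E ∘L L) := by
  obtain ⟨a, ha, hLa⟩ := hL
  obtain ⟨c, hc, hcE⟩ := exists_smul_one_le hE
  refine isStrictlyPositive_of_smul_one_le (c := c * a ^ 2) (by positivity) ?_
  refine le_of_inner_le ((IsSelfAdjoint.all _).smul (.one _)) (hE.isSelfAdjoint.adjoint_conj L)
    fun x => ?_
  have h1 := inner_le_of_le hcE (L x)
  have h2 : (a * ‖x‖) ^ 2 ≤ ‖L x‖ ^ 2 := by
    have := hLa x
    gcongr
  simp only [smul_apply, one_apply_eq_self, inner_smul_left, real_inner_self_eq_norm_sq,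
    conj_trivial, comp_apply, adjoint_inner_left] at h1 ⊢
  nlinarith

/-- The linear operator whose graph is the parallel composition of a strictly positive operator. -/
noncomputable def parallelOp (L : H →L[ℝ] G) (E : G →L[ℝ] G) : H →L[ℝ] H :=
  (adjoint L ∘L E⁻¹ʳ ∘L L)⁻¹ʳ

theorem isStrictlyPositive_parallelOp {L : H →L[ℝ] G} (hL : BoundedBelow L) {E : G →L[ℝ] G}
    (hE : IsStrictlyPositive E) : IsStrictlyPositive (parallelOp L E) :=
  (isStrictlyPositive_adjoint_comp hL hE.ringInverse).ringInverse

/-- The vector `y = E⁻¹ L (P E) x` is the minimizer of `⟪E y, y⟫` under the constraint `L* y = x`.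
This lemma says that the value is attained; the next one says that it is minimal. -/
theorem exists_inner_parallelOp_eq {L : H →L[ℝ] G} (hL : BoundedBelow L) {E : G →L[ℝ] G}
    (hE : IsStrictlyPositive E) (x : H) :
    ∃ y, adjoint L y = x ∧ E y = L (parallelOp L E x) ∧
      inner ℝ (E y) y = inner ℝ (parallelOp L E x) x := by
  have hy : adjoint L (E⁻¹ʳ (L (parallelOp L E x))) = x :=
    apply_inverse_self (isStrictlyPositive_adjoint_comp hL hE.ringInverse).isUnit x
  refine ⟨E⁻¹ʳ (L (parallelOp L E x)), hy, apply_inverse_self hE.isUnit _, ?_⟩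
  rw [apply_inverse_self hE.isUnit, ← adjoint_inner_right, hy]

/-- If `z` is the minimizer over the fibre of `y`, then `⟪E z, y⟫` and `⟪E z, z⟫` both equal the
left side, so expanding `⟪E (y - z), y - z⟫ ≥ 0` leaves the claim. -/
theorem inner_parallelOp_adjoint_le {L : H →L[ℝ] G} (hL : BoundedBelow L) {E : G →L[ℝ] G}
    (hE : IsStrictlyPositive E) (y : G) :
    inner ℝ (parallelOp L E (adjoint L y)) (adjoint L y) ≤ inner ℝ (E y) y := by
  obtain ⟨z, hz, hEz, hin⟩ := exists_inner_parallelOp_eq hL hE (adjoint L y)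
  have h1 := inner_le_of_le hE.nonneg (y - z)
  have h2 : inner ℝ (E z) y = inner ℝ (parallelOp L E (adjoint L y)) (adjoint L y) := by
    rw [hEz, adjoint_inner_right]
  have h3 := inner_map_comm hE.isSelfAdjoint y z
  rw [real_inner_comm (E z) y] at h3
  simp only [map_sub, inner_sub_left, inner_sub_right, zero_apply, inner_zero_left] at h1
  linarith

/-- The minimizer for `F` is a competitor in the minimization problem for `E`. -/
theorem parallelOp_mono {L : H →L[ℝ] G} (hL : BoundedBelow L) {E F : G →L[ℝ] G}
    (hE : IsStrictlyPositive E) (h : E ≤ F) : parallelOp L E ≤ parallelOp L F := by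
  have hF := isStrictlyPositive_of_le hE h
  refine le_of_inner_le (isStrictlyPositive_parallelOp hL hE).isSelfAdjoint
    (isStrictlyPositive_parallelOp hL hF).isSelfAdjoint fun x => ?_
  obtain ⟨y, rfl, -, hy⟩ := exists_inner_parallelOp_eq hL hF x
  rw [← hy]
  exact (inner_parallelOp_adjoint_le hL hE y).trans (inner_le_of_le h y)

theorem isStrictlyPositive_add_smul_one {E : G →L[ℝ] G} (hE : IsStrictlyPositive E) {d : ℝ}
    (hd : 0 ≤ d) : IsStrictlyPositive (E + d • (1 : G →L[ℝ] G)) :=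
  isStrictlyPositive_of_le hE (le_add_of_nonneg_right (smul_nonneg hd zero_le_one))

/-- At the minimizer `y` for `E + d Id`, the shift costs `d ‖y‖²`, which is at least `d ‖L* y‖² = d
‖x‖²`; this is where `‖L‖ ≤ 1` enters. -/
theorem parallelOp_add_smul_one_le {L : H →L[ℝ] G} (hL : BoundedBelow L) (hL1 : ‖L‖ ≤ 1)
    {E : G →L[ℝ] G} (hE : IsStrictlyPositive E) {d : ℝ} (hd : 0 ≤ d) :
    parallelOp L E + d • (1 : H →L[ℝ] H) ≤ parallelOp L (E + d • (1 : G →L[ℝ] G)) := by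
  have hF := isStrictlyPositive_add_smul_one hE hd
  refine le_of_inner_le ((isStrictlyPositive_parallelOp hL hE).isSelfAdjoint.add
    ((IsSelfAdjoint.all _).smul (.one _)))
    (isStrictlyPositive_parallelOp hL hF).isSelfAdjoint fun x => ?_
  obtain ⟨y, rfl, -, hy⟩ := exists_inner_parallelOp_eq hL hF x
  rw [← hy]
  have h1 := inner_parallelOp_adjoint_le hL hE y
  have h2 : ‖adjoint L y‖ ^ 2 ≤ ‖y‖ ^ 2 := by
    have h3 := (adjoint L).le_of_opNorm_le (c := 1) (by rwa [LinearIsometryEquiv.norm_map]) y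
    rw [one_mul] at h3
    gcongr
  simp only [add_apply, inner_add_left, smul_apply, one_apply_eq_self, inner_smul_left,
    real_inner_self_eq_norm_sq, conj_trivial]
  nlinarith

theorem parallelOp_smul {L : H →L[ℝ] G} (hL : BoundedBelow L) {E : G →L[ℝ] G}
    (hE : IsStrictlyPositive E) {c : ℝ} (hc : c ≠ 0) :
    parallelOp L (c • E) = c • parallelOp L E := by
  rw [parallelOp, inverse_smul hE.isUnit hc, smul_comp, comp_smul,
    inverse_smul (isStrictlyPositive_adjoint_comp hL hE.ringInverse).isUnit (inv_ne_zero hc),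
    inv_inv, parallelOp]

/-- The linear operator whose graph is the resolvent cocomposition of a strictly positive
operator. -/
noncomputable def cocompOp (L : H →L[ℝ] G) (γ : ℝ) (C : G →L[ℝ] G) : H →L[ℝ] H :=
  (parallelOp L (C⁻¹ʳ + γ • (1 : G →L[ℝ] G)) - γ • (1 : H →L[ℝ] H))⁻¹ʳ

theorem isStrictlyPositive_parallelOp_sub {L : H →L[ℝ] G} (hL : BoundedBelow L) (hL1 : ‖L‖ ≤ 1)
    {γ : ℝ} (hγ : 0 < γ) {D : G →L[ℝ] G} (hD : IsStrictlyPositive D) :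
    IsStrictlyPositive (parallelOp L (D + γ • (1 : G →L[ℝ] G)) - γ • (1 : H →L[ℝ] H)) :=
  isStrictlyPositive_of_le (isStrictlyPositive_parallelOp hL hD)
    (le_sub_iff_add_le.mpr (parallelOp_add_smul_one_le hL hL1 hD hγ.le))

theorem isStrictlyPositive_cocompOp {L : H →L[ℝ] G} (hL : BoundedBelow L) (hL1 : ‖L‖ ≤ 1)
    {γ : ℝ} (hγ : 0 < γ) {C : G →L[ℝ] G} (hC : IsStrictlyPositive C) :
    IsStrictlyPositive (cocompOp L γ C) :=
  (isStrictlyPositive_parallelOp_sub hL hL1 hγ hC.ringInverse).ringInverse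

/-- After inverting, the claim becomes `P (D⁻¹ + γ) - γ ≤ m (P (C⁻¹ + γ) - γ)`, where `D⁻¹ ≤ m C⁻¹`.
Homogeneity of `P` moves `m` inside. -/
theorem cocompOp_le_smul {L : H →L[ℝ] G} (hL : BoundedBelow L) (hL1 : ‖L‖ ≤ 1)
    {γ : ℝ} (hγ : 0 < γ) {C D : G →L[ℝ] G} (hC : IsStrictlyPositive C) (hD : IsStrictlyPositive D)
    {m : ℝ} (hm : 1 ≤ m) (h : C ≤ m • D) : cocompOp L γ C ≤ m • cocompOp L γ D := by
  have hm0 : 0 < m := one_pos.trans_le hm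
  have hC' := hC.ringInverse
  have hD' := hD.ringInverse
  have hinv : D⁻¹ʳ ≤ m • C⁻¹ʳ := by
    have h1 := inverse_le_inverse hC h
    rw [inverse_smul hD.isUnit hm0.ne'] at h1
    have h2 := smul_le_smul_of_nonneg_left h1 hm0.le
    rwa [smul_smul, mul_inv_cancel₀ hm0.ne', one_smul] at h2
  have hDγ := isStrictlyPositive_add_smul_one hD' hγ.le
  have key : parallelOp L (D⁻¹ʳ + γ • (1 : G →L[ℝ] G)) - γ • (1 : H →L[ℝ] H) ≤
      m • (parallelOp L (C⁻¹ʳ + γ • (1 : G →L[ℝ] G)) - γ • (1 : H →L[ℝ] H)) := by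
    rw [smul_sub, ← parallelOp_smul hL (isStrictlyPositive_add_smul_one hC' hγ.le) hm0.ne']
    -- Since `m γ = γ + (m - 1) γ`, the excess shift is `(m - 1) γ`, nonnegative because `m ≥ 1`.
    have h3 := parallelOp_add_smul_one_le hL hL1 hDγ (d := (m - 1) * γ)
      (mul_nonneg (by linarith) hγ.le)
    have h4 : D⁻¹ʳ + γ • (1 : G →L[ℝ] G) + ((m - 1) * γ) • (1 : G →L[ℝ] G) ≤
        m • (C⁻¹ʳ + γ • (1 : G →L[ℝ] G)) := by
      have h5 : m • (C⁻¹ʳ + γ • (1 : G →L[ℝ] G)) =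
          m • C⁻¹ʳ + γ • (1 : G →L[ℝ] G) + ((m - 1) * γ) • (1 : G →L[ℝ] G) := by module
      rw [h5]
      gcongr
    have h6 := h3.trans (parallelOp_mono hL (isStrictlyPositive_of_le hDγ
      (le_add_of_nonneg_right (smul_nonneg (mul_nonneg (by linarith) hγ.le) zero_le_one))) h4)
    rw [le_sub_iff_add_le]
    refine le_trans (le_of_eq ?_) h6
    module
  have h7 := inverse_le_inverse (isStrictlyPositive_parallelOp_sub hL hL1 hγ hD') key
  rw [inverse_smul (isStrictlyPositive_parallelOp_sub hL hL1 hγ hC').isUnit hm0.ne'] at h7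
  have h8 := smul_le_smul_of_nonneg_left h7 hm0.le
  rwa [smul_smul, mul_inv_cancel₀ hm0.ne', one_smul] at h8

theorem parallelComp_toSetOp {L : H →L[ℝ] G} (hL : BoundedBelow L) {E : G →L[ℝ] G}
    (hE : IsStrictlyPositive E) : parallelComp L (toSetOp E) = toSetOp (parallelOp L E) := by
  have h : sandwich L (toSetOp E⁻¹ʳ) = toSetOp (adjoint L ∘L E⁻¹ʳ ∘L L) := by
    ext x u
    simp [sandwich, toSetOp]
  rw [parallelComp, invOp_toSetOp hE.isUnit, h,
    invOp_toSetOp (isStrictlyPositive_adjoint_comp hL hE.ringInverse).isUnit, parallelOp]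

/-- Every set-valued inverse occurring in the definition is taken of a strictly positive, hence
invertible, operator, so the construction never leaves single-valued operators. -/
theorem resolventCocomp_toSetOp {L : H →L[ℝ] G} (hL : BoundedBelow L) (hL1 : ‖L‖ ≤ 1)
    {γ : ℝ} (hγ : 0 < γ) {C : G →L[ℝ] G} (hC : IsStrictlyPositive C) :
    resolventCocomp L γ (toSetOp C) = toSetOp (cocompOp L γ C) := by
  have h := isStrictlyPositive_parallelOp_sub hL hL1 hγ hC.ringInverse
  rw [sub_eq_add_neg, ← neg_smul] at h
  rw [resolventCocomp, resolventComp, one_div, inv_inv, invOp_toSetOp hC.isUnit, addId_toSetOp,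
    parallelComp_toSetOp hL (isStrictlyPositive_add_smul_one hC.ringInverse hγ.le), addId_toSetOp,
    invOp_toSetOp h.isUnit, cocompOp, sub_eq_add_neg, ← neg_smul]

end ParallelComposition

/-! ### The weighted geometric mean: homogeneity and monotonicity -/

section GeometricMean

variable {G : Type*} [NormedAddCommGroup G] [InnerProductSpace ℝ G] [CompleteSpace G]

theorem smul_rpow {A : G →L[ℝ] G} (hA : IsStrictlyPositive A) {c : ℝ} (hc : 0 < c) (y : ℝ) :
    (c • A) ^ y = c ^ y • A ^ y := by
  have hsa := hA.isSelfAdjoint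
  have hpos : ∀ x ∈ spectrum ℝ A, 0 < x := fun x hx => hA.spectrum_pos hx
  have hcont : ContinuousOn (fun x : ℝ => x ^ y) (spectrum ℝ A) :=
    continuousOn_id.rpow_const fun x hx => Or.inl (hpos x hx).ne'
  rw [← cfc_const_mul_id c A, CFC.cfc_rpow (fun x hx => mul_pos hc (hpos x hx)),
    CFC.rpow_eq_cfc_real hA.nonneg, ← cfc_const_mul (c ^ y) _ A hcont]
  exact cfc_congr fun x hx => Real.mul_rpow hc.le (hpos x hx).le

theorem isStrictlyPositive_geomMean {A B : G →L[ℝ] G} (hA : IsStrictlyPositive A)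
    (hB : IsStrictlyPositive B) (t : ℝ) : IsStrictlyPositive (geomMean t A B) := by
  have h1 := hA.rpow A (1 / 2)
  have h2 := hA.rpow A (-(1 / 2))
  exact IsStrictlyPositive.conjugate_of_isUnit_of_isSelfAdjoint _ _ h1.isUnit h1.isSelfAdjoint
    ((IsStrictlyPositive.conjugate_of_isUnit_of_isSelfAdjoint _ _ h2.isUnit h2.isSelfAdjoint
      hB).rpow _ t)

/-- The outer square roots contribute `c`, and the inner conjugation contributes `c⁻¹`, raised to
the power `t`. -/
theorem geomMean_smul {A B : G →L[ℝ] G} (hA : IsStrictlyPositive A)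
    (hB : IsStrictlyPositive B) (t : ℝ) {c : ℝ} (hc : 0 < c) :
    geomMean t (c • A) B = c ^ (1 - t) • geomMean t A B := by
  have h2 := hA.rpow A (-(1 / 2))
  have hT := IsStrictlyPositive.conjugate_of_isUnit_of_isSelfAdjoint B _ h2.isUnit
    h2.isSelfAdjoint hB
  have e1 : c ^ (-(1 / 2) : ℝ) * c ^ (-(1 / 2) : ℝ) = c⁻¹ := by
    rw [← Real.rpow_add hc, ← Real.rpow_neg_one]
    norm_num
  have e2 : c ^ (1 / 2 : ℝ) * c⁻¹ ^ t * c ^ (1 / 2 : ℝ) = c ^ (1 - t) := by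
    rw [Real.inv_rpow hc.le, ← Real.rpow_neg hc.le, ← Real.rpow_add hc, ← Real.rpow_add hc]
    ring_nf
  simp only [geomMean]
  rw [smul_rpow hA hc, smul_rpow hA hc]
  simp only [smul_mul_assoc, mul_smul_comm, smul_smul]
  rw [e1, smul_rpow hT (inv_pos.mpr hc)]
  simp only [smul_mul_assoc, mul_smul_comm, smul_smul]
  rw [← e2]
  ring_nf

theorem rpow_half_mul_rpow_half {A : G →L[ℝ] G} (hA : IsStrictlyPositive A) :
    A ^ (1 / 2 : ℝ) * A ^ (1 / 2 : ℝ) = A := by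
  rw [← CFC.rpow_add hA.isUnit, add_halves, CFC.rpow_one A hA.nonneg]

/-- On the spectrum the integrand is `s ^ (p - 1) x / (s + x)`, and `s / x + 1 = (s + x) / x`. The
product form identifies the integrand without inverting `s + T`. -/
theorem cfcₙ_rpowIntegrand_mul {T : G →L[ℝ] G} (hT : IsStrictlyPositive T) {p s : ℝ}
    (hp : p ∈ Set.Ioo 0 1) (hs : 0 < s) :
    cfcₙ (Real.rpowIntegrand₀₁ p s) T * (s • T⁻¹ʳ + 1) = s ^ (p - 1) • 1 := by
  have hsa := hT.isSelfAdjoint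
  have hnn : spectrum ℝ T ⊆ Set.Ici 0 := fun x hx => (hT.spectrum_pos hx).le
  have hnn' : quasispectrum ℝ T ⊆ Set.Ici 0 := fun x hx =>
    quasispectrum_nonneg_of_nonneg T hT.nonneg x hx
  have hcont := Real.continuousOn_rpowIntegrand₀₁_Ici hp hs
  have h1 : cfcₙ (Real.rpowIntegrand₀₁ p s) T * (s • 1 + T) = s ^ (p - 1) • T := by
    rw [cfcₙ_eq_cfc (hcont.mono hnn') Real.rpowIntegrand₀₁_zero_right]
    have h2 : s • 1 + T = cfc (fun x : ℝ => s + x) T := by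
      rw [cfc_const_add s (fun x : ℝ => x) T, cfc_id' ℝ T, Algebra.algebraMap_eq_smul_one]
    have h3 : s ^ (p - 1) • T = cfc (fun x : ℝ => s ^ (p - 1) * x) T :=
      (cfc_const_mul_id _ T).symm
    rw [h2, h3, ← cfc_mul _ _ T (hcont.mono hnn)]
    refine cfc_congr fun x hx => ?_
    have hx0 := hT.spectrum_pos hx
    rw [Real.rpowIntegrand₀₁_eq_pow_div hp hs.le hx0.le, div_mul_cancel₀ _ (by positivity)]
  calc _ = cfcₙ (Real.rpowIntegrand₀₁ p s) T * (s • 1 + T) * T⁻¹ʳ := by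
        rw [mul_assoc, add_mul, Ring.mul_inverse_cancel _ hT.isUnit, smul_one_mul]
    _ = _ := by rw [h1, smul_mul_assoc, Ring.mul_inverse_cancel _ hT.isUnit]

/-- The integrand of the integral representation of the geometric mean is a multiple of a parallel
sum. -/
theorem conj_cfcₙ_rpowIntegrand {A B : G →L[ℝ] G} (hA : IsStrictlyPositive A)
    (hB : IsStrictlyPositive B) {p s : ℝ} (hp : p ∈ Set.Ioo 0 1) (hs : 0 < s) :
    A ^ (1 / 2 : ℝ) * cfcₙ (Real.rpowIntegrand₀₁ p s)
        (A ^ (-(1 / 2) : ℝ) * B * A ^ (-(1 / 2) : ℝ)) * A ^ (1 / 2 : ℝ) =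
      s ^ (p - 1) • (s • B⁻¹ʳ + A⁻¹ʳ)⁻¹ʳ := by
  have h2 := hA.rpow A (-(1 / 2))
  have hT := IsStrictlyPositive.conjugate_of_isUnit_of_isSelfAdjoint B _ h2.isUnit
    h2.isSelfAdjoint hB
  set T := A ^ (-(1 / 2) : ℝ) * B * A ^ (-(1 / 2) : ℝ) with hTdef
  set R := A ^ (1 / 2 : ℝ) with hR
  set S := A ^ (-(1 / 2) : ℝ) with hS
  have hRS : R * S = 1 := CFC.rpow_mul_rpow_neg _ hA
  have hSR : S * R = 1 := CFC.rpow_neg_mul_rpow _ hA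
  have hRR : R * R = A := rpow_half_mul_rpow_half hA
  have hBB := Ring.mul_inverse_cancel _ hB.isUnit
  have hBB' := Ring.inverse_mul_cancel _ hB.isUnit
  have hTinv : T⁻¹ʳ = R * B⁻¹ʳ * R := by
    refine inverse_eq_of_mul_eq_one ?_ ?_
    · calc T * (R * B⁻¹ʳ * R) = S * B * (S * R) * B⁻¹ʳ * R := by rw [hTdef]; noncomm_ring
        _ = 1 := by rw [hSR, mul_one, mul_assoc S, hBB, mul_one, hSR]
    · calc R * B⁻¹ʳ * R * T = R * B⁻¹ʳ * (R * S) * B * S := by rw [hTdef]; noncomm_ring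
        _ = 1 := by rw [hRS, mul_one, mul_assoc R, hBB', mul_one, hRS]
  have hAinv : A⁻¹ʳ = S * S := by
    refine inverse_eq_of_mul_eq_one ?_ ?_
    · calc A * (S * S) = R * (R * S) * S := by rw [← hRR]; noncomm_ring
        _ = 1 := by rw [hRS, mul_one, hRS]
    · calc S * S * A = S * (S * R) * R := by rw [← hRR]; noncomm_ring
        _ = 1 := by rw [hSR, mul_one, hSR]
  have hE : IsStrictlyPositive (s • B⁻¹ʳ + A⁻¹ʳ) :=
    isStrictlyPositive_of_le hA.ringInverse
      (le_add_of_nonneg_left (smul_nonneg hs.le hB.ringInverse.nonneg))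
  set K := cfcₙ (Real.rpowIntegrand₀₁ p s) T
  have key : R * K * R * (s • B⁻¹ʳ + A⁻¹ʳ) = s ^ (p - 1) • 1 := by
    calc R * K * R * (s • B⁻¹ʳ + A⁻¹ʳ)
        = R * (K * (s • T⁻¹ʳ + 1)) * S := by
          -- Since `T⁻¹ = R B⁻¹ R` and `A⁻¹ = S S` with `R S = 1`, the sum passes through `R` and
          -- becomes the factor treated in `cfcₙ_rpowIntegrand_mul`.
          have e1 : R * (s • B⁻¹ʳ + A⁻¹ʳ) = (s • T⁻¹ʳ + 1) * S := by
            rw [hTinv, hAinv, mul_add, add_mul, one_mul, ← mul_assoc R S S, hRS, one_mul,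
              smul_mul_assoc, mul_assoc (R * B⁻¹ʳ), hRS, mul_one, mul_smul_comm]
          rw [mul_assoc (R * K), e1]
          noncomm_ring
      _ = _ := by
          rw [cfcₙ_rpowIntegrand_mul hT hp hs, mul_smul_comm, mul_one, smul_mul_assoc, hRS]
  rw [← Ring.mul_inverse_cancel_right _ (R * K * R) hE.isUnit, key, smul_one_mul]

/-- In the defining formula `A` also occurs with negative powers, so monotonicity is not visible. In
the integral representation `A` occurs only in `(s B⁻¹ + A⁻¹)⁻¹`, where two order-reversing
inversions compose to a monotone map. -/
theorem geomMean_mono {t : ℝ} (ht : t ∈ Set.Ioo 0 1) {A A' B : G →L[ℝ] G}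
    (hA : IsStrictlyPositive A) (hB : IsStrictlyPositive B) (h : A ≤ A') :
    geomMean t A B ≤ geomMean t A' B := by
  have hA' := isStrictlyPositive_of_le hA h
  refine le_of_inner_le (isStrictlyPositive_geomMean hA hB t).isSelfAdjoint
    (isStrictlyPositive_geomMean hA' hB t).isSelfAdjoint fun x => ?_
  lift t to NNReal using ht.1.le
  have ht' : t ∈ Set.Ioo 0 1 := ⟨by exact_mod_cast ht.1, by exact_mod_cast ht.2⟩
  obtain ⟨μ, hμ⟩ := CFC.exists_measure_nnrpow_eq_integral_cfcₙ_rpowIntegrand₀₁ (G →L[ℝ] G) ht'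
  have key : ∀ C : G →L[ℝ] G, IsStrictlyPositive C →
      MeasureTheory.IntegrableOn
        (fun s => inner ℝ ((s ^ ((t : ℝ) - 1) • (s • B⁻¹ʳ + C⁻¹ʳ)⁻¹ʳ) x) x) (Set.Ioi 0) μ ∧
      inner ℝ (geomMean t C B x) x =
        ∫ s in Set.Ioi 0, inner ℝ ((s ^ ((t : ℝ) - 1) • (s • B⁻¹ʳ + C⁻¹ʳ)⁻¹ʳ) x) x ∂μ := by
    intro C hC
    have h2 := hC.rpow C (-(1 / 2))
    have hT := IsStrictlyPositive.conjugate_of_isUnit_of_isSelfAdjoint B _ h2.isUnit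
      h2.isSelfAdjoint hB
    set T := C ^ (-(1 / 2) : ℝ) * B * C ^ (-(1 / 2) : ℝ) with hTdef
    set R := C ^ (1 / 2 : ℝ) with hR
    -- Conjugation by `R` followed by the quadratic form at `x` is a continuous linear functional,
    -- so it commutes with the operator-valued integral and reduces the comparison to real
    -- integrals.
    let Λ : (G →L[ℝ] G) →L[ℝ] ℝ :=
      (innerSL ℝ x) ∘L (ContinuousLinearMap.apply ℝ G x) ∘L
        (ContinuousLinearMap.mul ℝ (G →L[ℝ] G)).flip R ∘L
          (ContinuousLinearMap.mul ℝ (G →L[ℝ] G)) R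
    have hΛ : ∀ K, Λ K = inner ℝ ((R * K * R) x) x := fun K => real_inner_comm _ _
    obtain ⟨hint, heq⟩ := hμ T hT.nonneg
    have hcongr : Set.EqOn (fun s => Λ (cfcₙ (Real.rpowIntegrand₀₁ t s) T))
        (fun s => inner ℝ ((s ^ ((t : ℝ) - 1) • (s • B⁻¹ʳ + C⁻¹ʳ)⁻¹ʳ) x) x) (Set.Ioi 0) := by
      intro s hs
      change Λ (cfcₙ _ T) = _
      rw [hΛ, conj_cfcₙ_rpowIntegrand hC hB ht hs]
    refine ⟨MeasureTheory.IntegrableOn.congr_fun (Λ.integrable_comp hint) hcongr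
      measurableSet_Ioi, ?_⟩
    rw [← MeasureTheory.setIntegral_congr_fun measurableSet_Ioi hcongr]
    refine Eq.trans ?_ (Λ.integral_comp_comm hint).symm
    have hgoal : inner ℝ (geomMean t C B x) x = Λ (T ^ (t : ℝ)) := (hΛ _).symm
    rw [hgoal, ← CFC.nnrpow_eq_rpow ht'.1, heq]
  rw [(key A hA).2, (key A' hA').2]
  refine MeasureTheory.setIntegral_mono_on (key A hA).1 (key A' hA').1 measurableSet_Ioi
    fun s hs => inner_le_of_le (smul_le_smul_of_nonneg_left ?_ (Real.rpow_nonneg hs.le _)) x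
  refine inverse_le_inverse (isStrictlyPositive_of_le hA'.ringInverse (le_add_of_nonneg_left
    (smul_nonneg hs.le hB.ringInverse.nonneg))) ?_
  gcongr
  exact inverse_le_inverse hA h

theorem geomMean_le_smul {t : ℝ} (ht : t ∈ Set.Ioo 0 1) {A A' B : G →L[ℝ] G}
    (hA : IsStrictlyPositive A) (hA' : IsStrictlyPositive A') (hB : IsStrictlyPositive B) {c : ℝ}
    (hc : 0 < c) (h : A ≤ c • A') : geomMean t A B ≤ c ^ (1 - t) • geomMean t A' B := by
  rw [← geomMean_smul hA' hB t hc]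
  exact geomMean_mono ht hA hB h

end GeometricMean

/-! ### The Thompson gauge: elementary bounds -/

section

variable {H : Type*} [NormedAddCommGroup H] [InnerProductSpace ℝ H]

theorem thompsonGauge_nonneg (A B : H →L[ℝ] H) : 0 ≤ thompsonGauge A B :=
  Real.sInf_nonneg fun _ h => h.1.le

theorem thompsonGauge_le {A B : H →L[ℝ] H} {l : ℝ} (hl : 0 < l) (h : A ≤ l • B) :
    thompsonGauge A B ≤ l :=
  csInf_le ⟨0, fun _ h => h.1.le⟩ ⟨hl, h⟩

theorem thompson_comm (A B : H →L[ℝ] H) : thompson A B = thompson B A := by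
  rw [thompson, thompson, max_comm]

/-- Here every `λ > 0` is admissible, so both gauges are `0`, and the value `Real.log 0 = 0` agrees
with the convention for the zero space. -/
theorem thompson_of_subsingleton [Subsingleton H] (A B : H →L[ℝ] H) : thompson A B = 0 := by
  have h : ∀ A B : H →L[ℝ] H, thompsonGauge A B = 0 := fun A B => by
    refine le_antisymm (le_of_forall_pos_le_add fun e he => ?_) (thompsonGauge_nonneg A B)
    rw [zero_add]
    exact thompsonGauge_le he (Subsingleton.elim _ _).le
  rw [thompson, h, h, max_self, Real.log_zero]

theorem thompson_le {A B : H →L[ℝ] H} {r : ℝ} (hr : 0 ≤ r) (h : A ≤ Real.exp r • B)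
    (h' : B ≤ Real.exp r • A) : thompson A B ≤ r := by
  have hm : max (thompsonGauge A B) (thompsonGauge B A) ≤ Real.exp r :=
    max_le (thompsonGauge_le (Real.exp_pos r) h) (thompsonGauge_le (Real.exp_pos r) h')
  rcases (le_max_of_le_left (thompsonGauge_nonneg A B) :
    0 ≤ max (thompsonGauge A B) (thompsonGauge B A)).eq_or_lt with h0 | h0
  · rwa [thompson, ← h0, Real.log_zero]
  · rwa [thompson, Real.log_le_iff_le_exp h0]

end

/-! ### The Thompson metric and its completeness -/

section Thompson

open Filter Topology

variable {H : Type*} [NormedAddCommGroup H] [InnerProductSpace ℝ H] [CompleteSpace H]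

theorem smul_le_smul_of_nonneg {B : H →L[ℝ] H} (hB : 0 ≤ B) {a b : ℝ} (h : a ≤ b) :
    a • B ≤ b • B := by
  rw [← sub_nonneg, ← sub_smul]
  exact smul_nonneg (sub_nonneg.mpr h) hB

theorem exists_le_smul {A B : H →L[ℝ] H} (hA : IsSelfAdjoint A) (hB : IsStrictlyPositive B) :
    ∃ l : ℝ, 0 < l ∧ A ≤ l • B := by
  obtain ⟨c, hc, hcB⟩ := exists_smul_one_le hB
  refine ⟨(‖A‖ + 1) / c, by positivity, ?_⟩
  calc A ≤ ‖A‖ • (1 : H →L[ℝ] H) := le_norm_smul_one hA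
    _ ≤ (‖A‖ + 1) • (1 : H →L[ℝ] H) :=
      smul_le_smul_of_nonneg zero_le_one (le_add_of_nonneg_right zero_le_one)
    _ = ((‖A‖ + 1) / c) • (c • (1 : H →L[ℝ] H)) := by
      rw [smul_smul, div_mul_cancel₀ _ hc.ne']
    _ ≤ _ := smul_le_smul_of_nonneg_left hcB (by positivity)

/-- The infimum is admissible in the inequality because, tested on each `x`, the condition is closed
in `λ`. -/
theorem le_thompsonGauge_smul {A B : H →L[ℝ] H} (hA : IsSelfAdjoint A)
    (hB : IsStrictlyPositive B) : A ≤ thompsonGauge A B • B := by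
  refine le_of_inner_le hA ((IsSelfAdjoint.all _).smul hB.isSelfAdjoint) fun x => ?_
  rw [smul_apply, inner_smul_left, conj_trivial]
  obtain ⟨l, hl, hle⟩ := exists_le_smul hA hB
  have hmem : thompsonGauge A B ∈ closure {l : ℝ | 0 < l ∧ A ≤ l • B} :=
    csInf_mem_closure ⟨l, hl, hle⟩ ⟨0, fun _ h => h.1.le⟩
  have hcl : IsClosed {l : ℝ | inner ℝ (A x) x ≤ l * inner ℝ (B x) x} :=
    isClosed_le continuous_const (by fun_prop)
  refine closure_minimal (fun m hm => ?_) hcl hmem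
  have := inner_le_of_le hm.2 x
  rwa [smul_apply, inner_smul_left, conj_trivial] at this

/-- Going from `A` to `B` and back gives `⟪A x, x⟫ ≤ g(A, B) g(B, A) ⟪A x, x⟫`, so both gauges
cannot be less than `1`; a nonzero `x` makes the form positive. -/
theorem one_le_max_thompsonGauge [Nontrivial H] {A B : H →L[ℝ] H} (hA : IsStrictlyPositive A)
    (hB : IsStrictlyPositive B) : 1 ≤ max (thompsonGauge A B) (thompsonGauge B A) := by
  obtain ⟨x, hx⟩ := exists_ne (0 : H)
  obtain ⟨c, hc, hcA⟩ := exists_smul_one_le hA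
  have h0 := inner_le_of_le hcA x
  rw [smul_apply, inner_smul_left, conj_trivial, one_apply_eq_self,
    real_inner_self_eq_norm_sq] at h0
  have hpos : 0 < inner ℝ (A x) x := lt_of_lt_of_le (by positivity) h0
  have h1 := inner_le_of_le (le_thompsonGauge_smul hA.isSelfAdjoint hB) x
  have h2 := inner_le_of_le (le_thompsonGauge_smul hB.isSelfAdjoint hA) x
  rw [smul_apply, inner_smul_left, conj_trivial] at h1 h2
  by_contra! h
  obtain ⟨h3, h4⟩ := max_lt_iff.mp h
  have h5 := thompsonGauge_nonneg A B
  have h6 := thompsonGauge_nonneg B A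
  nlinarith [mul_le_mul_of_nonneg_left h2 h5, mul_lt_mul_of_pos_right h4 hpos]

theorem thompson_nonneg {A B : H →L[ℝ] H} (hA : IsStrictlyPositive A)
    (hB : IsStrictlyPositive B) : 0 ≤ thompson A B := by
  rcases subsingleton_or_nontrivial H with hs | hn
  · exact (thompson_of_subsingleton A B).ge
  · exact Real.log_nonneg (one_le_max_thompsonGauge hA hB)

theorem le_exp_thompson_smul {A B : H →L[ℝ] H} (hA : IsStrictlyPositive A)
    (hB : IsStrictlyPositive B) : A ≤ Real.exp (thompson A B) • B := by
  rcases subsingleton_or_nontrivial H with hs | hn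
  · exact (Subsingleton.elim _ _).le
  · rw [thompson, Real.exp_log (one_pos.trans_le (one_le_max_thompsonGauge hA hB))]
    exact (le_thompsonGauge_smul hA.isSelfAdjoint hB).trans
      (smul_le_smul_of_nonneg hB.nonneg (le_max_left _ _))

theorem thompson_triangle {A B C : H →L[ℝ] H} (hA : IsStrictlyPositive A)
    (hB : IsStrictlyPositive B) (hC : IsStrictlyPositive C) :
    thompson A C ≤ thompson A B + thompson B C := by
  have key : ∀ {X Y Z : H →L[ℝ] H}, IsStrictlyPositive X → IsStrictlyPositive Y →
      IsStrictlyPositive Z → X ≤ Real.exp (thompson X Y + thompson Y Z) • Z := by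
    intro X Y Z hX hY hZ
    rw [Real.exp_add, mul_smul]
    exact (le_exp_thompson_smul hX hY).trans
      (smul_le_smul_of_nonneg_left (le_exp_thompson_smul hY hZ) (Real.exp_pos _).le)
  refine thompson_le (add_nonneg (thompson_nonneg hA hB) (thompson_nonneg hB hC))
    (key hA hB hC) ?_
  rw [thompson_comm A B, thompson_comm B C, add_comm]
  exact key hC hB hA

theorem thompson_self {A : H →L[ℝ] H} (hA : IsStrictlyPositive A) : thompson A A = 0 :=
  le_antisymm (thompson_le le_rfl (by simp) (by simp)) (thompson_nonneg hA hA)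

theorem eq_of_thompson_eq_zero {A B : H →L[ℝ] H} (hA : IsStrictlyPositive A)
    (hB : IsStrictlyPositive B) (h : thompson A B = 0) : A = B := by
  have h1 := le_exp_thompson_smul hA hB
  have h2 := le_exp_thompson_smul hB hA
  rw [thompson_comm B A] at h2
  rw [h, Real.exp_zero, one_smul] at h1 h2
  exact le_antisymm h1 h2

/-- A map between strictly positive operators that is monotone and subhomogeneous of degree `s`,
in the sense that `A ≤ c B` implies `f A ≤ c ^ s f B` for `c ≥ 1`, is `s`-Lipschitzian. -/
theorem thompson_le_mul_thompson {K : Type*} [NormedAddCommGroup K] [InnerProductSpace ℝ K]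
    {f : (H →L[ℝ] H) → (K →L[ℝ] K)} {s : ℝ} (hs : 0 ≤ s)
    (hf : ∀ X Y, IsStrictlyPositive X → IsStrictlyPositive Y → ∀ c : ℝ, 1 ≤ c → X ≤ c • Y →
      f X ≤ c ^ s • f Y)
    {X Y : H →L[ℝ] H} (hX : IsStrictlyPositive X) (hY : IsStrictlyPositive Y) :
    thompson (f X) (f Y) ≤ s * thompson X Y := by
  have key : ∀ {X Y : H →L[ℝ] H}, IsStrictlyPositive X → IsStrictlyPositive Y →
      f X ≤ Real.exp (s * thompson X Y) • f Y := by
    intro X Y hX hY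
    have h := hf X Y hX hY _ (Real.one_le_exp (thompson_nonneg hX hY))
      (le_exp_thompson_smul hX hY)
    rwa [← Real.exp_mul, mul_comm] at h
  refine thompson_le (mul_nonneg hs (thompson_nonneg hX hY)) (key hX hY) ?_
  rw [thompson_comm X Y]
  exact key hY hX

variable (H) in
/-- The strictly positive operators, with the Thompson metric instead of the metric induced by the
operator norm. -/
def ThompsonSpace : Type _ := StrictlyPositive H

noncomputable instance : MetricSpace (ThompsonSpace H) where
  dist A B := thompson A.1 B.1
  dist_self A := thompson_self (mem_strictlyPositive_iff.mp A.2)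
  dist_comm A B := thompson_comm _ _
  dist_triangle A B C := thompson_triangle (mem_strictlyPositive_iff.mp A.2)
    (mem_strictlyPositive_iff.mp B.2) (mem_strictlyPositive_iff.mp C.2)
  eq_of_dist_eq_zero h := Subtype.ext (eq_of_thompson_eq_zero (mem_strictlyPositive_iff.mp
    (Subtype.prop _)) (mem_strictlyPositive_iff.mp (Subtype.prop _)) h)

theorem norm_le_of_abs_inner_le {T : H →L[ℝ] H} (hT : IsSelfAdjoint T) {c : ℝ} (hc : 0 ≤ c)
    (h : ∀ x, |inner ℝ (T x) x| ≤ c * ‖x‖ ^ 2) : ‖T‖ ≤ c := by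
  rw [norm_eq_iSup_rayleighQuotient T hT.isSymmetric]
  refine ciSup_le fun x => ?_
  rw [rayleighQuotient, reApplyInnerSelf_apply, abs_div, abs_sq]
  exact div_le_of_le_mul₀ (sq_nonneg _) hc (h x)

/-- On a norm-bounded set, the Thompson metric controls the norm. -/
theorem norm_sub_le_exp_thompson {A B : H →L[ℝ] H} (hA : IsStrictlyPositive A)
    (hB : IsStrictlyPositive B) {M r : ℝ} (hr : thompson A B ≤ r) (hAM : ‖A‖ ≤ M)
    (hBM : ‖B‖ ≤ M) : ‖A - B‖ ≤ (Real.exp r - 1) * M := by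
  have hr0 := (thompson_nonneg hA hB).trans hr
  have hM := (norm_nonneg A).trans hAM
  have he : 0 ≤ Real.exp r - 1 := sub_nonneg.mpr (Real.one_le_exp hr0)
  have key : ∀ {A B : H →L[ℝ] H}, IsStrictlyPositive A → IsStrictlyPositive B →
      thompson A B ≤ r → ‖B‖ ≤ M → ∀ x, inner ℝ (A x) x - inner ℝ (B x) x ≤
        (Real.exp r - 1) * M * ‖x‖ ^ 2 := by
    intro A B hA hB hr hBM x
    have h1 := inner_le_of_le ((le_exp_thompson_smul hA hB).trans
      (smul_le_smul_of_nonneg hB.nonneg (Real.exp_le_exp.mpr hr))) x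
    have h2 := inner_le_of_le (le_norm_smul_one hB.isSelfAdjoint) x
    rw [smul_apply, inner_smul_left, conj_trivial] at h1 h2
    rw [one_apply_eq_self, real_inner_self_eq_norm_sq] at h2
    have h3 : inner ℝ (B x) x ≤ M * ‖x‖ ^ 2 :=
      h2.trans (mul_le_mul_of_nonneg_right hBM (sq_nonneg _))
    nlinarith [mul_le_mul_of_nonneg_left h3 he]
  refine norm_le_of_abs_inner_le (hA.isSelfAdjoint.sub hB.isSelfAdjoint) (mul_nonneg he hM)
    fun x => ?_
  rw [sub_apply, inner_sub_left, abs_sub_le_iff]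
  exact ⟨key hA hB hr hBM x, key hB hA ((thompson_comm B A).trans_le hr) hAM x⟩

theorem isClosed_nonneg : IsClosed {T : H →L[ℝ] H | 0 ≤ T} := by
  have h : {T : H →L[ℝ] H | 0 ≤ T} =
      {T | star T = T} ∩ ⋂ x, {T : H →L[ℝ] H | 0 ≤ inner ℝ (T x) x} := by
    ext T
    rw [Set.mem_ofPred_eq, nonneg_iff_isPositive, isPositive_iff']
    simp [isSelfAdjoint_iff]
  rw [h]
  refine (isClosed_eq continuous_star continuous_id).inter (isClosed_iInter fun x => ?_)
  exact isClosed_le continuous_const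
    (((ContinuousLinearMap.apply ℝ H x).continuous).inner continuous_const)

/-- A Thompson-Cauchy sequence is bounded in norm, hence Cauchy in norm. Its norm limit inherits the
order inequalities because the positive cone is closed, and these give both strict positivity of the
limit and convergence in the Thompson metric. -/
instance : CompleteSpace (ThompsonSpace H) := by
  refine Metric.complete_of_cauchySeq_tendsto fun u hu => ?_
  have hpos : ∀ n, IsStrictlyPositive (u n).1 :=
    fun n => mem_strictlyPositive_iff.mp (u n).2
  obtain ⟨b, -, hb, hb0⟩ := cauchySeq_iff_le_tendsto_0.mp hu
  have hbd : ∀ n m N, N ≤ n → N ≤ m → thompson (u n).1 (u m).1 ≤ b N := hb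
  set M := Real.exp (b 0) * ‖(u 0).1‖
  have hle : ∀ n m N, N ≤ n → N ≤ m →
      (u n).1 ≤ Real.exp (b N) • (u m).1 := fun n m N hn hm =>
    (le_exp_thompson_smul (hpos n) (hpos m)).trans
      (smul_le_smul_of_nonneg (hpos m).nonneg (Real.exp_le_exp.mpr (hbd n m N hn hm)))
  have hM : ∀ n, ‖(u n).1‖ ≤ M := by
    intro n
    refine norm_le_of_abs_inner_le (hpos n).isSelfAdjoint (by positivity) fun x => ?_
    have h0 := inner_le_of_le (hpos n).nonneg x
    rw [zero_apply, inner_zero_left] at h0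
    rw [abs_of_nonneg h0]
    have h1 := inner_le_of_le ((hle n 0 0 n.zero_le le_rfl).trans (smul_le_smul_of_nonneg_left
      (le_norm_smul_one (hpos 0).isSelfAdjoint) (Real.exp_pos _).le)) x
    rwa [smul_smul, smul_apply, inner_smul_left, conj_trivial, one_apply_eq_self,
      real_inner_self_eq_norm_sq] at h1
  have hcau : CauchySeq fun n => (u n).1 := by
    refine cauchySeq_of_le_tendsto_0 (fun N => (Real.exp (b N) - 1) * M)
      (fun n m N hn hm => ?_) ?_
    · rw [dist_eq_norm]
      exact norm_sub_le_exp_thompson (hpos n) (hpos m) (hbd n m N hn hm) (hM n) (hM m)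
    · have h := (((Real.continuous_exp.tendsto 0).comp hb0).sub_const 1).mul_const M
      simpa using h
  obtain ⟨T, hT⟩ := cauchySeq_tendsto_of_complete hcau
  have h1 : ∀ n, (u n).1 ≤ Real.exp (b n) • T := fun n => by
    rw [← sub_nonneg]
    refine isClosed_nonneg.mem_of_tendsto ((hT.const_smul (Real.exp (b n))).sub_const _) ?_
    filter_upwards [eventually_ge_atTop n] with m hm
    exact sub_nonneg.mpr (hle n m n le_rfl hm)
  have h2 : ∀ n, T ≤ Real.exp (b n) • (u n).1 := fun n => by
    rw [← sub_nonneg]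
    refine isClosed_nonneg.mem_of_tendsto (hT.const_sub _) ?_
    filter_upwards [eventually_ge_atTop n] with m hm
    exact sub_nonneg.mpr (hle m n n hm le_rfl)
  -- Norm limits of strictly positive operators may degenerate; here `T ≥ e^(-b 0) u 0` prevents it.
  have hTpos : IsStrictlyPositive T := by
    have h := isStrictlyPositive_of_le (hpos 0) (h1 0)
    have h3 := h.smul (inv_pos.mpr (Real.exp_pos (b 0)))
    rwa [smul_smul, inv_mul_cancel₀ (Real.exp_pos _).ne', one_smul] at h3
  refine ⟨⟨T, mem_strictlyPositive_iff.mpr hTpos⟩, tendsto_iff_dist_tendsto_zero.mpr ?_⟩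
  refine squeeze_zero (fun _ => dist_nonneg) (fun n => ?_) hb0
  exact thompson_le ((thompson_nonneg (hpos n) (hpos n)).trans (hbd n n n le_rfl le_rfl))
    (h1 n) (h2 n)

end Thompson

/-! ### The contraction and its fixed point -/

theorem cocompOp_geomMean_le_smul {H G : Type*} [NormedAddCommGroup H] [InnerProductSpace ℝ H]
    [CompleteSpace H] [NormedAddCommGroup G] [InnerProductSpace ℝ G] [CompleteSpace G]
    {L : H →L[ℝ] G} (hL : BoundedBelow L) (hL1 : ‖L‖ ≤ 1) {γ : ℝ} (hγ : 0 < γ) {t : ℝ}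
    (ht : t ∈ Set.Ioo 0 1) {B : G →L[ℝ] G} (hB : IsStrictlyPositive B) {X Y : G →L[ℝ] G}
    (hX : IsStrictlyPositive X) (hY : IsStrictlyPositive Y) {c : ℝ} (hc : 1 ≤ c)
    (h : X ≤ c • Y) :
    cocompOp L γ (geomMean t X B) ≤ c ^ (1 - t) • cocompOp L γ (geomMean t Y B) :=
  cocompOp_le_smul hL hL1 hγ (isStrictlyPositive_geomMean hX hB t)
    (isStrictlyPositive_geomMean hY hB t) (Real.one_le_rpow hc (sub_nonneg.mpr ht.2.le))
    (geomMean_le_smul ht hX hY hB (one_pos.trans_le hc) h)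

theorem thompson_cocompOp_geomMean_le {H G : Type*} [NormedAddCommGroup H]
    [InnerProductSpace ℝ H] [CompleteSpace H] [NormedAddCommGroup G] [InnerProductSpace ℝ G]
    [CompleteSpace G] {L : H →L[ℝ] G} (hL : BoundedBelow L) (hL1 : ‖L‖ ≤ 1) {γ : ℝ} (hγ : 0 < γ)
    {t : ℝ} (ht : t ∈ Set.Ioo 0 1) {B : G →L[ℝ] G} (hB : IsStrictlyPositive B) {X Y : G →L[ℝ] G}
    (hX : IsStrictlyPositive X) (hY : IsStrictlyPositive Y) :
    thompson (cocompOp L γ (geomMean t X B)) (cocompOp L γ (geomMean t Y B)) ≤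
      (1 - t) * thompson X Y :=
  thompson_le_mul_thompson (f := fun X => cocompOp L γ (geomMean t X B))
    (sub_nonneg.mpr ht.2.le)
    (fun _ _ hX hY _ hc h => cocompOp_geomMean_le_smul hL hL1 hγ ht hB hX hY hc h) hX hY

/-- The Banach fixed point theorem for the Thompson metric. -/
theorem existsUnique_fixedPoint_of_thompson_le {H : Type*} [NormedAddCommGroup H]
    [InnerProductSpace ℝ H] [CompleteSpace H] (f : StrictlyPositive H → StrictlyPositive H)
    {s : ℝ} (hs0 : 0 ≤ s) (hs1 : s < 1)
    (hf : ∀ X Y, thompson (f X : H →L[ℝ] H) (f Y) ≤ s * thompson (X : H →L[ℝ] H) Y) :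
    ∃! X, f X = X := by
  let g : ThompsonSpace H → ThompsonSpace H := f
  have : Nonempty (ThompsonSpace H) :=
    ⟨⟨1, mem_strictlyPositive_iff.mpr isStrictlyPositive_one⟩⟩
  lift s to NNReal using hs0
  have hc : ContractingWith s g := ⟨by exact_mod_cast hs1, LipschitzWith.of_dist_le_mul hf⟩
  have h : ∃! X, g X = X :=
    ⟨hc.fixedPoint g, hc.fixedPoint_isFixedPt, fun X hX => hc.fixedPoint_unique hX⟩
  exact h

end RealHilbert

open RealHilbert
theorem proposition5p3 {H : Type*} [NormedAddCommGroup H] [InnerProductSpace ℝ H] [CompleteSpace H]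
    (γ : ℝ) (hγ : 0 < γ) (t : ℝ) (ht0 : 0 < t) (ht1 : t < 1) :
    (∀ {G : Type*} [NormedAddCommGroup G] [InnerProductSpace ℝ G] [CompleteSpace G]
        (L : H →L[ℝ] G) (_ : BoundedBelow L) (_ : ‖L‖ ≤ 1)
        (B : G →L[ℝ] G) (_ : B ∈ StrictlyPositive G),
      ∃ φ : StrictlyPositive G → StrictlyPositive H,
        (∀ X : StrictlyPositive G,
          toSetOp (φ X : H →L[ℝ] H) = resolventCocomp L γ (toSetOp (geomMean t (X : G →L[ℝ] G) B))) ∧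
        ∀ X Y : StrictlyPositive G,
          thompson (φ X : H →L[ℝ] H) (φ Y) ≤ (1 - t) * thompson (X : G →L[ℝ] G) Y) ∧
    (∀ (L : H →L[ℝ] H) (_ : BoundedBelow L) (_ : ‖L‖ ≤ 1)
        (B : H →L[ℝ] H) (_ : B ∈ StrictlyPositive H),
      ∃! X : H →L[ℝ] H, X ∈ StrictlyPositive H ∧
        toSetOp X = resolventCocomp L γ (toSetOp (geomMean t X B))) := by
  have ht : t ∈ Set.Ioo 0 1 := ⟨ht0, ht1⟩
  constructor
  · intro G _ _ _ L hL hL1 B hB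
    rw [mem_strictlyPositive_iff] at hB
    have hX : ∀ X : StrictlyPositive G, IsStrictlyPositive (X : G →L[ℝ] G) :=
      fun X => mem_strictlyPositive_iff.mp X.2
    have hC := fun X : StrictlyPositive G => isStrictlyPositive_geomMean (hX X) hB t
    exact ⟨fun X => ⟨cocompOp L γ (geomMean t X B),
      mem_strictlyPositive_iff.mpr (isStrictlyPositive_cocompOp hL hL1 hγ (hC X))⟩,
      fun X => (resolventCocomp_toSetOp hL hL1 hγ (hC X)).symm,
      fun X Y => thompson_cocompOp_geomMean_le hL hL1 hγ ht hB (hX X) (hX Y)⟩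
  · intro L hL hL1 B hB
    rw [mem_strictlyPositive_iff] at hB
    have hX : ∀ X : StrictlyPositive H, IsStrictlyPositive (X : H →L[ℝ] H) :=
      fun X => mem_strictlyPositive_iff.mp X.2
    have hC := fun X : StrictlyPositive H => isStrictlyPositive_geomMean (hX X) hB t
    let f : StrictlyPositive H → StrictlyPositive H := fun X => ⟨cocompOp L γ (geomMean t X B),
      mem_strictlyPositive_iff.mpr (isStrictlyPositive_cocompOp hL hL1 hγ (hC X))⟩
    -- An operator is determined by its graph, so the set-valued equation is exactly the fixed point
    -- equation of `f`.
    have hf : ∀ X : StrictlyPositive H, f X = X ↔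
        toSetOp (X : H →L[ℝ] H) = resolventCocomp L γ (toSetOp (geomMean t X B)) := fun X => by
      rw [resolventCocomp_toSetOp hL hL1 hγ (hC X), toSetOp_injective.eq_iff, Subtype.ext_iff,
        eq_comm]
    obtain ⟨X, hfX, huniq⟩ := existsUnique_fixedPoint_of_thompson_le f
      (sub_nonneg.mpr ht1.le) (sub_lt_self 1 ht0)
      fun X Y => thompson_cocompOp_geomMean_le hL hL1 hγ ht hB (hX X) (hX Y)
    exact ⟨X, ⟨X.2, (hf X).mp hfX⟩,
      fun Y hY => congrArg Subtype.val (huniq ⟨Y, hY.1⟩ ((hf ⟨Y, hY.1⟩).mpr hY.2))⟩
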